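/- Let $\mathcal S,\mathcal A$ be measurable state and action spaces, $\rho$ an initial state distribution, $\mathcal T$ a transition kernel shared by all tasks, $h\in\mathbb N$ a horizon and $\gamma\in[0,1]$ a discount factor. Every task is identified with a parameter $\theta\in\mathbb R^d$ and has reward function $r_\theta:\mathcal S\times\mathcal A\to\mathbb R$. Let $\mathcal P$ be a given set of policies $\pi:\mathcal S\to\mathcal A$, and put $$V_\theta^\pi=\mathbb E\Big[\sum_{t=0}^{h}\gamma^t r_\theta(s_t,a_t)\,\Big|\,a_t=\pi(s_t)\Big],\qquad V_\theta^*=\sup_{\pi\in\mathcal P}V_\theta^\pi,\qquad V_\theta^\Pi=\max_{\pi\in\Pi}V_\theta^\pi$$ for a finite nonempty committee $\Pi\subseteq\mathcal P$; assume that these expectations exist and the suprema are finite. For a probability distribution $\Gamma$ on $\mathbb R^d$, the committee $\Pi$ is an $(a,q)$-cover of $\Gamma$ if $\Pr_{\theta\sim\Gamma}[V_\theta^\Pi\ge V_\theta^*-a]\ge q$; a set $C=\{\theta_1,\dots,\theta_K\}\subset\mathbb R^d$ is an $(\varepsilon,q)$-parameter-cover of $\Gamma$ if $\Pr_{\theta\sim\Gamma}[\min_k\|\theta-\theta_k\|_\infty\le\varepsilon]\ge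 q$. Let $\delta^*(K,\varepsilon)$ be the infimum of the $\delta\in[0,1]$ for which there is an $(\varepsilon,1-\delta)$-parameter-cover of $\Gamma$ by $K$ points. **Theorem.** Suppose that $\sup_{s,a}|r_\theta(s,a)-r_{\theta'}(s,a)|\le L\|\theta-\theta'\|_\infty$ for all $\theta,\theta'$, where $L\ge 0$, and let $K\ge 1$ and $\varepsilon\ge 0$. Then there is a procedure, which may use the model ($\mathcal S,\mathcal A,\rho,\mathcal T,h,\gamma,r,\mathcal P$), $K$ and $\varepsilon$ but not $\Gamma$, that maps every finite sample $T=(\theta_1,\dots,\theta_n)$ of task parameters to $K$ representative parameters $\hat\theta_1,\dots,\hat\theta_K$, such that the following holds. Suppose that for every task $\theta$ we can find a policy $\pi_\theta\in\mathcal P$ with $V_\theta^{\pi_\theta}\ge V_\theta^*-\eta$. Let $\Gamma$ be any probability distribution on $\mathbb R^d$, let $\alpha\in(0,1)$ and $\beta>0$, and let $T$ consist of $n\ge\frac{9\log(5/\alpha)}{2\beta^2}$ i.i.d. samples from $\Gamma$. Then, with probability at least $1-\alpha$ over $T$, the committee $\Pi=\{\pi_{\hat\theta_1},\dots,\pi_{\hat\theta_K}\}$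 is a $$\Big(2L\,\tfrac{1-\gamma^{h+1}}{1-\gamma}\,\varepsilon+\eta,\ \big(1-\tfrac1e\big)\big(1-\delta^*(K,\varepsilon)-K\beta\big)\Big)\text{-cover of }\Gamma\quad\text{if }\gamma<1,$$ $$\Big(2L(h+1)\,\varepsilon+\eta,\ \big(1-\tfrac1e\big)\big(1-\delta^*(K,\varepsilon)-K\beta\big)\Big)\text{-cover of }\Gamma\quad\text{if }\gamma=1.$$ -/

import Mathlib

open MeasureTheory ProbabilityTheory

namespace PolicyCommittee

/-- A dynamic environment with state space `S` and action space `A`, together with the transition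
model, which is shared by all tasks. -/
structure Environment (S A : Type*) [MeasurableSpace S] [MeasurableSpace A] where
  /-- the decision horizon `h`; rewards are collected at times `0, …, h` -/
  horizon : ℕ
  /-- the discount factor `γ` -/
  discount : ℝ
  discount_nonneg : 0 ≤ discount
  discount_le_one : discount ≤ 1
  /-- the initial state distribution `ρ` -/
  init : Measure S
  init_prob : IsProbabilityMeasure init
  /-- the distribution of the next state, given the current state and action -/
  transition : Kernel (S × A) S
  transition_markov : IsMarkovKernel transition

attribute [instance] Environment.init_prob Environment.transition_markov

/-- A policy chooses the action `π s` in state `s`. -/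
abbrev Policy (S A : Type*) [MeasurableSpace S] [MeasurableSpace A] : Type _ :=
  {π : S → A // Measurable π}

section Model

variable {S A : Type*} [MeasurableSpace S] [MeasurableSpace A]

/-- The law of the next state at time `n + 1` given the states at times `0, …, n`, when actions
are chosen by `π`: it is `transition (s_n, π s_n)`. -/
noncomputable def stepKernel (E : Environment S A) (π : Policy S A) (n : ℕ) :
    Kernel (∀ _ : Finset.Iic n, S) S :=
  E.transition.comap
    (fun x => (x ⟨n, Finset.mem_Iic.2 le_rfl⟩, π.1 (x ⟨n, Finset.mem_Iic.2 le_rfl⟩)))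
    ((measurable_pi_apply _).prodMk (π.2.comp (measurable_pi_apply _)))

instance (E : Environment S A) (π : Policy S A) (n : ℕ) : IsMarkovKernel (stepKernel E π n) := by
  unfold stepKernel
  infer_instance

/-- The law of the state trajectory `(s_0, s_1, …)` when actions are chosen by `π`. -/
noncomputable def stateLaw (E : Environment S A) (π : Policy S A) : Measure (ℕ → S) :=
  Kernel.trajMeasure (X := fun _ => S) E.init (stepKernel E π)

/-- The value `𝔼[∑_{t=0}^h γ^t r(s_t, a_t) | a_t = π(s_t)]` of the policy `π` for the task with
reward function `r`. -/
noncomputable def value (E : Environment S A) (r : S → A → ℝ) (π : Policy S A) : ℝ :=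
  ∫ s, ∑ t ∈ Finset.range (E.horizon + 1), E.discount ^ t * r (s t) (π.1 (s t)) ∂(stateLaw E π)

/-- The optimal value for the task with reward function `r` over the policy space `P`. -/
noncomputable def optValue (E : Environment S A) (P : Set (Policy S A)) (r : S → A → ℝ) : ℝ :=
  sSup ((fun π => value E r π) '' P)

/-- The value of a committee of `K` policies: that of its best member (a maximum if `0 < K`). -/
noncomputable def committeeValue (E : Environment S A) (r : S → A → ℝ) {K : ℕ}
    (c : Fin K → Policy S A) : ℝ :=
  ⨆ k, value E r (c k)

/-- The committee `c` is an `(acc, q)`-cover for the task distribution `Γ` on parameters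
`θ ∈ ℝ^d`, the task `θ` having reward function `r θ`: with probability at least `q` over `θ ∼ Γ`,
the value of the committee is within `acc` of the optimal value. -/
def IsCommitteeCover (E : Environment S A) (P : Set (Policy S A)) {d : ℕ}
    (r : (Fin d → ℝ) → S → A → ℝ) (Γ : Measure (Fin d → ℝ)) {K : ℕ} (c : Fin K → Policy S A)
    (acc q : ℝ) : Prop :=
  q ≤ Γ.real {θ | optValue E P (r θ) - acc ≤ committeeValue E (r θ) c}

end Model

/-- The representatives `C 0, …, C (K - 1)` form an `(ε, q)`-parameter-cover of `Γ`: with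
probability at least `q` over `θ ∼ Γ`, the smallest `ℓ_∞` distance from `θ` to a representative
is at most `ε`. (The norm of `Fin d → ℝ` is the `ℓ_∞` norm.) -/
def IsParameterCover {d K : ℕ} (Γ : Measure (Fin d → ℝ)) (C : Fin K → Fin d → ℝ) (ε q : ℝ) : Prop :=
  q ≤ Γ.real {θ | ∃ k, ‖θ - C k‖ ≤ ε}

/-- `δ*(K, ε)`: the smallest `δ ∈ [0, 1]` for which `K` representatives can form an
`(ε, 1 - δ)`-parameter-cover of `Γ`. -/
noncomputable def deltaStar {d : ℕ} (Γ : Measure (Fin d → ℝ)) (K : ℕ) (ε : ℝ) : ℝ :=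
  sInf {δ : ℝ | 0 ≤ δ ∧ δ ≤ 1 ∧ ∃ C : Fin K → Fin d → ℝ, IsParameterCover Γ C ε (1 - δ)}

end PolicyCommittee

/-! The procedure picks `K` entries of the sample that cover as many sample entries as possible,
where `x` covers `y` if they are within `2ε` and the optimal value at `x` is at least that at `y`.
The value condition saves a factor: with `G = ∑ γ^t`, a policy that is `η`-optimal for `x` loses at
`y` at most `η` plus one transfer of its own value from `x` to `y`, which costs `2LGε`. The optimal
value need not be transferred as well.

Picking from the sample loses nothing against arbitrary centres. Among the sample points in a ball
of radius `ε`, one of maximal optimal value covers all the others. So the best `K` entries cover at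
least as many entries as lie in the `K` balls of a near-optimal parameter-cover of mass `p`. By
Hoeffding this number exceeds `n (p - β/3)` except with probability `α/5`.

It remains to pass from the sample to `Γ`, by a union bound over the `n ^ K` choices of indices.
Once the chosen entries are fixed, the set they cover is fixed and the other entries are still
i.i.d., so Chernoff applies; the chosen entries add at most `K` hits. The factor `1 - 1/e` is not an
approximation loss, since the maximization is exact: it gives multiplicative slack, which makes the
Chernoff exponent linear in `Kβ` rather than quadratic. This beats `n ^ K` without any complexity
bound on the covering sets (`measureReal_le_hits_coveredBy_le`, `deviation_rate`, `pow_mul_exp_le`).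
-/

namespace PolicyCommittee

/-! ### Concentration of the number of hits -/

section Sampling

variable {X ι : Type*}

/-- The number of entries of the sample `T` that lie in `U`. -/
noncomputable def hits [Fintype ι] (U : Set X) (T : ι → X) : ℝ :=
  ∑ i, U.indicator (fun _ => (1 : ℝ)) (T i)

/-- The points related by `W` to one of the representatives `c k`. -/
def coveredBy (W : Set (X × X)) {K : ℕ} (c : Fin K → X) : Set X :=
  {y | ∃ k, (c k, y) ∈ W}

lemma hits_mono [Fintype ι] {U V : Set X} {T : ι → X} (h : ∀ i, T i ∈ U → T i ∈ V) :
    hits U T ≤ hits V T := by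
  refine Finset.sum_le_sum fun i _ => ?_
  by_cases hU : T i ∈ U
  · simp [hU, h i hU]
  · rw [Set.indicator_of_notMem hU]
    exact Set.indicator_nonneg (fun _ _ => zero_le_one) _

variable [MeasurableSpace X]

lemma measurable_hits [Fintype ι] {U : Set X} (hU : MeasurableSet U) :
    Measurable (fun T : ι → X => hits U T) :=
  Finset.measurable_sum _ fun i _ =>
    (measurable_const.indicator hU).comp (measurable_pi_apply i)

lemma iIndepFun_indicator_pi [Fintype ι] (μ : Measure X) [IsProbabilityMeasure μ] {U : Set X}
    (hU : MeasurableSet U) :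
    iIndepFun (fun (i : ι) (T : ι → X) => U.indicator (fun _ => (1 : ℝ)) (T i))
      (Measure.pi fun _ => μ) :=
  iIndepFun_pi (X := fun _ => U.indicator (fun _ => (1 : ℝ)))
    fun _ => (measurable_const.indicator hU).aemeasurable

lemma mgf_indicator_eval [Fintype ι] (μ : Measure X) [IsProbabilityMeasure μ] {U : Set X}
    (hU : MeasurableSet U) (i : ι) (l : ℝ) :
    mgf (fun T : ι → X => U.indicator (fun _ => (1 : ℝ)) (T i)) (Measure.pi fun _ => μ) l
      = 1 + μ.real U * (Real.exp l - 1) := by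
  have hmp := measurePreserving_eval (fun _ : ι => μ) i
  have h1 : (fun x => Real.exp (l * U.indicator (fun _ => (1 : ℝ)) x))
      = fun x => 1 + U.indicator (fun _ => Real.exp l - 1) x := by
    funext x
    by_cases hx : x ∈ U <;> simp [hx]
  have h2 : mgf (fun T : ι → X => U.indicator (fun _ => (1 : ℝ)) (T i)) (Measure.pi fun _ => μ) l
      = ∫ x, Real.exp (l * U.indicator (fun _ => (1 : ℝ)) x) ∂μ := by
    have h := integral_map (μ := Measure.pi fun _ : ι => μ) hmp.measurable.aemeasurable
      (f := fun x => Real.exp (l * U.indicator (fun _ => (1 : ℝ)) x))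
      (Real.measurable_exp.comp
        ((measurable_const.indicator hU).const_mul l)).aestronglyMeasurable
    rw [hmp.map_eq] at h
    exact h.symm
  rw [h2, h1, integral_add (integrable_const _) ((integrable_const _).indicator hU),
    integral_indicator_const _ hU]
  simp

/-- Chernoff's bound for the upper tail of the number of hits. -/
lemma measureReal_le_hits_le [Fintype ι] (μ : Measure X) [IsProbabilityMeasure μ] {U : Set X}
    (hU : MeasurableSet U) {q l s : ℝ} {n : ℕ} (hq : μ.real U ≤ q) (hl : 0 ≤ l)
    (hn : Fintype.card ι ≤ n) :
    (Measure.pi fun _ : ι => μ).real {T | s ≤ hits U T}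
      ≤ Real.exp (-l * s + n * q * (Real.exp l - 1)) := by
  have hexp : 0 ≤ Real.exp l - 1 := by linarith [Real.one_le_exp hl]
  have hmeas := measurable_hits (ι := ι) hU
  have hbd : ∀ T : ι → X, hits U T ∈ Set.Icc (0 : ℝ) (Fintype.card ι) := fun T => by
    refine ⟨Finset.sum_nonneg fun i _ => Set.indicator_nonneg (fun _ _ => zero_le_one) _, ?_⟩
    calc hits U T ≤ ∑ _i : ι, (1 : ℝ) := Finset.sum_le_sum fun i _ =>
          Set.indicator_le_self' (fun _ _ => zero_le_one) _
      _ = Fintype.card ι := by simp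
  have hint : Integrable (fun T : ι → X => Real.exp (l * hits U T)) (Measure.pi fun _ => μ) :=
    integrable_exp_mul_of_mem_Icc hmeas.aemeasurable (.of_forall hbd)
  refine (measure_ge_le_exp_mul_mgf s hl hint).trans ?_
  have hmgf : mgf (fun T : ι → X => hits U T) (Measure.pi fun _ => μ) l
      = (1 + μ.real U * (Real.exp l - 1)) ^ Fintype.card ι := by
    have h := (iIndepFun_indicator_pi (ι := ι) μ hU).mgf_sum (t := l)
      (fun i => (measurable_const.indicator hU).comp (measurable_pi_apply i)) Finset.univ
    simp only [mgf_indicator_eval μ hU, Finset.prod_const, Finset.card_univ] at h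
    rw [← h]
    congr 1
    funext T
    simp [hits]
  rw [hmgf, Real.exp_add]
  refine mul_le_mul_of_nonneg_left ?_ (Real.exp_nonneg _)
  have hq0 : 0 ≤ μ.real U := measureReal_nonneg
  calc (1 + μ.real U * (Real.exp l - 1)) ^ Fintype.card ι
      ≤ (1 + q * (Real.exp l - 1)) ^ Fintype.card ι := by gcongr
    _ ≤ (1 + q * (Real.exp l - 1)) ^ n :=
        pow_le_pow_right₀ (by nlinarith [mul_nonneg (hq0.trans hq) hexp]) hn
    _ ≤ Real.exp (q * (Real.exp l - 1)) ^ n := by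
        have := mul_nonneg (hq0.trans hq) hexp
        gcongr
        linarith [Real.add_one_le_exp (q * (Real.exp l - 1))]
    _ = Real.exp (n * q * (Real.exp l - 1)) := by
        rw [← Real.exp_nat_mul]; ring_nf

/-- Hoeffding's bound for the lower tail of the number of hits. -/
lemma measureReal_hits_le_le [Fintype ι] (μ : Measure X) [IsProbabilityMeasure μ] {U : Set X}
    (hU : MeasurableSet U) {t : ℝ} (ht : 0 ≤ t) (hι : 0 < Fintype.card ι) :
    (Measure.pi fun _ : ι => μ).real {T | hits U T ≤ Fintype.card ι * (μ.real U - t)}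
      ≤ Real.exp (-(2 * Fintype.card ι * t ^ 2)) := by
  set ν := Measure.pi fun _ : ι => μ
  have hev : ∀ i : ι, Measurable fun T : ι → X => U.indicator (fun _ => (1 : ℝ)) (T i) :=
    fun i => (measurable_const.indicator hU).comp (measurable_pi_apply i)
  have hmean : ∀ i : ι, ∫ T, U.indicator (fun _ => (1 : ℝ)) (T i) ∂ν = μ.real U := fun i => by
    have hmp := measurePreserving_eval (fun _ : ι => μ) i
    have h := integral_map (μ := ν) hmp.measurable.aemeasurable
      (f := U.indicator (fun _ => (1 : ℝ)))
      (measurable_const.indicator hU).aestronglyMeasurable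
    rw [hmp.map_eq, integral_indicator_const _ hU] at h
    simpa using h.symm
  have hsub : ∀ i ∈ Finset.univ, HasSubgaussianMGF
      (fun T : ι → X => -(U.indicator (fun _ => (1 : ℝ)) (T i) - μ.real U))
      ((‖(1 : ℝ) - 0‖₊ / 2) ^ 2) ν := fun i _ => by
    have h := hasSubgaussianMGF_of_mem_Icc (μ := ν) (a := 0) (b := 1) (hev i).aemeasurable
      (.of_forall fun T => ⟨Set.indicator_nonneg (fun _ _ => zero_le_one) _,
          Set.indicator_le_self' (fun _ _ => zero_le_one) _⟩)
    rw [hmean i] at h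
    exact h.neg
  have hind : iIndepFun (fun (i : ι) (T : ι → X) =>
      -(U.indicator (fun _ => (1 : ℝ)) (T i) - μ.real U)) ν :=
    (iIndepFun_indicator_pi μ hU).comp (fun _ x => -(x - μ.real U)) fun _ => by fun_prop
  have h := HasSubgaussianMGF.measure_sum_ge_le_of_iIndepFun hind hsub
    (ε := Fintype.card ι * t) (by positivity)
  have hset : {T : ι → X | Fintype.card ι * t ≤
        ∑ i, -(U.indicator (fun _ => (1 : ℝ)) (T i) - μ.real U)}
      = {T | hits U T ≤ Fintype.card ι * (μ.real U - t)} := by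
    ext T
    simp only [Set.mem_ofPred_eq, hits, Finset.sum_neg_distrib, Finset.sum_sub_distrib,
      Finset.sum_const, Finset.card_univ, nsmul_eq_mul]
    constructor <;> intro h <;> linarith
  rw [hset] at h
  refine h.trans (le_of_eq ?_)
  congr 1
  have hc : (Fintype.card ι : ℝ) ≠ 0 := by positivity
  simp
  field_simp

lemma measurableSet_coveredBy {W : Set (X × X)} (hW : MeasurableSet W) {K : ℕ} (c : Fin K → X) :
    MeasurableSet (coveredBy W c) := by
  have : coveredBy W c = ⋃ k, Prod.mk (c k) ⁻¹' W := by ext; simp [coveredBy]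
  rw [this]
  exact MeasurableSet.iUnion fun k => measurable_prodMk_left hW

lemma measurableSet_coveredBy_prod {W : Set (X × X)} (hW : MeasurableSet W) (K : ℕ) :
    MeasurableSet {p : (Fin K → X) × X | p.2 ∈ coveredBy W p.1} := by
  have : {p : (Fin K → X) × X | p.2 ∈ coveredBy W p.1}
      = ⋃ k, (fun p : (Fin K → X) × X => (p.1 k, p.2)) ⁻¹' W := by ext; simp [coveredBy]
  rw [this]
  exact MeasurableSet.iUnion fun k =>
    (((measurable_pi_apply k).comp measurable_fst).prodMk measurable_snd) hW

/-- Few representatives taken from the sample are unlikely to look much better on the sample than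
they are: only the other entries of the sample are random, given the representatives. -/
lemma measureReal_le_hits_coveredBy_le (μ : Measure X) [IsProbabilityMeasure μ]
    {W : Set (X × X)} (hW : MeasurableSet W) {K n : ℕ} (f : Fin K → Fin n) {q l s : ℝ}
    (hl : 0 ≤ l) :
    (Measure.pi fun _ : Fin n => μ).real
        {T | μ.real (coveredBy W (T ∘ f)) ≤ q ∧ s ≤ hits (coveredBy W (T ∘ f)) T}
      ≤ Real.exp (-l * (s - K) + n * q * (Real.exp l - 1)) := by
  classical
  obtain ⟨p, hp⟩ : ∃ p : Fin n → Prop, ∀ i, p i ↔ ∃ k, f k = i := ⟨_, fun _ => Iff.rfl⟩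
  have hcardp : (Fintype.card {i // p i} : ℝ) ≤ K := by
    have := Fintype.card_le_of_surjective
      (fun k => (⟨f k, (hp _).2 ⟨k, rfl⟩⟩ : {i // p i})) fun ⟨i, hi⟩ => by
        obtain ⟨k, rfl⟩ := (hp i).1 hi
        exact ⟨k, rfl⟩
    rw [Fintype.card_fin] at this
    exact_mod_cast this
  have hcardn : Fintype.card {i // ¬ p i} ≤ n := by
    simpa only [Fintype.card_fin] using Fintype.card_subtype_le (fun i => ¬ p i)
  have hmp := measurePreserving_piEquivPiSubtypeProd (fun _ : Fin n => μ) p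
  let c : ({i // p i} → X) → Fin K → X := fun x k => x ⟨f k, (hp _).2 ⟨k, rfl⟩⟩
  have hc : Measurable c := measurable_pi_lambda _ fun k => measurable_pi_apply _
  let B : Set (({i // p i} → X) × ({i // ¬ p i} → X)) :=
    {z | μ.real (coveredBy W (c z.1)) ≤ q ∧ s - K ≤ hits (coveredBy W (c z.1)) z.2}
  have hB : MeasurableSet B := by
    refine MeasurableSet.inter
      (s₁ := {z : ({i // p i} → X) × ({i // ¬ p i} → X) | μ.real (coveredBy W (c z.1)) ≤ q})
      (s₂ := {z : ({i // p i} → X) × ({i // ¬ p i} → X) | s - K ≤ hits (coveredBy W (c z.1)) z.2})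
      (measurableSet_le ?_ measurable_const) (measurableSet_le measurable_const ?_)
    · have h1 : Measurable fun c : Fin K → X => μ (coveredBy W c) :=
        measurable_measure_prodMk_left (measurableSet_coveredBy_prod hW K)
      exact (h1.comp (hc.comp measurable_fst)).ennreal_toReal
    · refine Finset.measurable_sum _ fun i _ => ?_
      have h2 : Measurable fun z : ({i // p i} → X) × ({i // ¬ p i} → X) => (c z.1, z.2 i) :=
        (hc.comp measurable_fst).prodMk ((measurable_pi_apply i).comp measurable_snd)
      exact (measurable_const.indicator (measurableSet_coveredBy_prod hW K)).comp h2
  have hsub : {T : Fin n → X | μ.real (coveredBy W (T ∘ f)) ≤ q ∧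
      s ≤ hits (coveredBy W (T ∘ f)) T} ⊆
      MeasurableEquiv.piEquivPiSubtypeProd (fun _ => X) p ⁻¹' B := by
    rintro T ⟨h1, h2⟩
    refine ⟨h1, ?_⟩
    -- The at most `K` chosen entries contribute at most `K` hits; the rest must come from the other
    -- entries.
    change s - K ≤ hits (coveredBy W (T ∘ f)) fun i : {i // ¬ p i} => T i
    have hsplit := Fintype.sum_subtype_add_sum_subtype p
      fun i => (coveredBy W (T ∘ f)).indicator (fun _ => (1 : ℝ)) (T i)
    have hle : ∑ i : {i // p i}, (coveredBy W (T ∘ f)).indicator (fun _ => (1 : ℝ)) (T i)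
        ≤ Fintype.card {i // p i} := by
      calc _ ≤ ∑ _i : {i // p i}, (1 : ℝ) := Finset.sum_le_sum fun i _ =>
            Set.indicator_le_self' (fun _ _ => zero_le_one) _
        _ = _ := by simp
    unfold hits at h2 ⊢
    linarith
  have hprod : ((Measure.pi fun _ : {i // p i} => μ).prod (Measure.pi fun _ : {i // ¬ p i} => μ)) B
      ≤ ENNReal.ofReal (Real.exp (-l * (s - K) + n * q * (Real.exp l - 1))) := by
    -- Fubini: for fixed chosen entries `x` the covered set is deterministic, so Chernoff's bound
    -- holds on each slice.
    rw [Measure.prod_apply hB]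
    refine (lintegral_mono (g := fun _ => ENNReal.ofReal
      (Real.exp (-l * (s - K) + n * q * (Real.exp l - 1)))) fun x => ?_).trans_eq (by simp)
    by_cases hx : μ.real (coveredBy W (c x)) ≤ q
    · rw [ENNReal.le_ofReal_iff_toReal_le (measure_ne_top _ _) (Real.exp_nonneg _)]
      refine (measureReal_mono ?_).trans
        (measureReal_le_hits_le μ (measurableSet_coveredBy hW (c x)) hx hl hcardn)
      exact fun y hy => hy.2
    · have : Prod.mk x ⁻¹' B = ∅ := by ext y; simp [B, hx]
      simp [this]
  refine ENNReal.toReal_le_of_le_ofReal (Real.exp_nonneg _) ?_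
  refine (measure_mono hsub).trans ?_
  rw [hmp.measure_preimage hB.nullMeasurableSet]
  exact hprod

end Sampling

end PolicyCommittee

namespace PolicyCommittee

/-! ### Numerical estimates for the constants -/

section Numerics

/-- Apply `log y ≤ y - 1` at `y = √x / e`. This is what makes `log n` small against `nβ` when `nβ²`
is bounded below. -/
lemma log_le_two_mul_sqrt_div_exp {x : ℝ} (hx : 0 < x) : Real.log x ≤ 2 * (x.sqrt / Real.exp 1) := by
  have hs : 0 < x.sqrt := Real.sqrt_pos.2 hx
  have h := Real.log_le_sub_one_of_pos (div_pos hs (Real.exp_pos 1))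
  rw [Real.log_div hs.ne' (Real.exp_pos 1).ne', Real.log_exp, Real.log_sqrt hx.le] at h
  linarith

lemma log_five_ge : (1.6 : ℝ) ≤ Real.log 5 := by
  rw [Real.le_log_iff_exp_le (by norm_num)]
  have h : Real.exp 1.6 ^ 5 ≤ (5 : ℝ) ^ 5 := by
    rw [← Real.exp_nat_mul, show ((5 : ℕ) : ℝ) * 1.6 = ((8 : ℕ) : ℝ) * 1 by norm_num,
      Real.exp_nat_mul]
    calc Real.exp 1 ^ 8 ≤ 2.7182818286 ^ 8 := by gcongr; exact Real.exp_one_lt_d9.le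
      _ ≤ 5 ^ 5 := by norm_num
  exact le_of_pow_le_pow_left₀ (by norm_num) (by norm_num) h

lemma log_four_ge : (4 / 5 : ℝ) ≤ Real.log 4 := by
  rw [show (4 : ℝ) = 2 ^ 2 by norm_num, Real.log_pow]
  have := Real.log_two_gt_d9
  norm_num at this ⊢
  linarith

lemma exp_four_fifths_mem : Real.exp (4 / 5) ∈ Set.Icc (2.22 : ℝ) 2.23 := by
  have h : Real.exp (4 / 5) ^ 5 = Real.exp 1 ^ 4 := by
    rw [← Real.exp_nat_mul, ← Real.exp_nat_mul]; norm_num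
  have h1 : (2.7182818283 : ℝ) ^ 4 ≤ Real.exp 1 ^ 4 := by gcongr; exact Real.exp_one_gt_d9.le
  have h2 : Real.exp 1 ^ 4 ≤ (2.7182818286 : ℝ) ^ 4 := by gcongr; exact Real.exp_one_lt_d9.le
  constructor
  · refine le_of_pow_le_pow_left₀ (n := 5) (by norm_num) (Real.exp_nonneg _) ?_
    rw [h]; refine le_trans ?_ h1; norm_num
  · refine le_of_pow_le_pow_left₀ (n := 5) (by norm_num) (by norm_num) ?_
    rw [h]; refine h2.trans ?_; norm_num

lemma one_sub_inv_exp_mem : 1 - 1 / Real.exp 1 ∈ Set.Icc (0.632 : ℝ) 0.6322 := by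
  have h1 := Real.exp_one_gt_d9
  have h2 := Real.exp_one_lt_d9
  have h3 : 1 / Real.exp 1 ≤ 1 / 2.7182818283 := by gcongr
  have h4 : 1 / 2.7182818286 ≤ 1 / Real.exp 1 := by gcongr
  norm_num at h3 h4 ⊢
  constructor <;> linarith

/-- The rate in the exponent of the deviation bound for `K` representatives. -/
lemma deviation_rate {p β k : ℝ} (hp : 0 ≤ p) (hβ : 0 ≤ β) (hk : 1 ≤ k) :
    k * β / 2 ≤ 4 / 5 * (p - β / 3)
      - (1 - 1 / Real.exp 1) * (p - k * β) * (Real.exp (4 / 5) - 1) := by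
  obtain ⟨h1, h2⟩ := one_sub_inv_exp_mem
  obtain ⟨h3, h4⟩ := exp_four_fifths_mem
  -- The Chernoff parameter `4/5` keeps `κ ≤ 4/5`, so the terms in `p` have the right sign, while `κ
  -- - 4/15 ≥ 1/2` leaves the rate `kβ/2`.
  set κ := (1 - 1 / Real.exp 1) * (Real.exp (4 / 5) - 1) with hκ
  have hκ1 : 0.771 ≤ κ := by nlinarith
  have hκ2 : κ ≤ 4 / 5 := by nlinarith
  have e : (1 - 1 / Real.exp 1) * (p - k * β) * (Real.exp (4 / 5) - 1) = κ * p - κ * (k * β) := by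
    rw [hκ]; ring
  rw [e]
  have h5 : κ * p ≤ 4 / 5 * p := by gcongr
  have h6 : 0.771 * (k * β) ≤ κ * (k * β) := by gcongr
  have h7 : β ≤ k * β := le_mul_of_one_le_left hβ hk
  linarith

/-- The sample size makes up for the number of choices of the representatives. -/
lemma pow_mul_exp_le {α β : ℝ} {n K : ℕ} (hα : 0 < α) (hα1 : α < 1) (hβ : 0 < β) (hβ1 : β ≤ 1)
    (hK : 0 < K) (hn : (n : ℝ) = 9 * Real.log (5 / α) / (2 * β ^ 2)) :
    (n : ℝ) ^ K * Real.exp (4 / 5 * K - n * (K * β / 2)) ≤ 4 * (α / 5) := by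
  set x : ℝ := (n : ℝ) with hxdef
  set Λ := Real.log (5 / α) with hΛdef
  have hΛ : Λ = 2 * x * β ^ 2 / 9 := by rw [hn]; field_simp
  have hΛ5 : 1.6 ≤ Λ := log_five_ge.trans <| Real.log_le_log (by norm_num) <| by
    rw [le_div_iff₀ hα]; linarith
  have hx : 0 < x := by rw [hn]; positivity
  have hk : (1 : ℝ) ≤ K := by exact_mod_cast hK
  have hsq : 7.2 ≤ x * β ^ 2 := by linarith
  have hsβ : 2.683 ≤ x.sqrt * β := by
    refine le_of_pow_le_pow_left₀ (n := 2) (by norm_num) (by positivity) ?_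
    rw [mul_pow, Real.sq_sqrt hx.le]
    exact le_trans (by norm_num) hsq
  have hlog : Real.log x ≤ 5 / 18 * (x * β) := by
    refine (log_le_two_mul_sqrt_div_exp hx).trans ?_
    have hs : 0 < x.sqrt := Real.sqrt_pos.2 hx
    have h1 : 1 / Real.exp 1 ≤ 0.368 := by
      have := one_sub_inv_exp_mem.1
      norm_num at this ⊢
      linarith
    have h2 : x * β = x.sqrt * (x.sqrt * β) := by rw [← mul_assoc, Real.mul_self_sqrt hx.le]
    rw [h2, div_eq_mul_one_div]
    nlinarith
  have hβ2 : x * β ^ 2 ≤ x * β := by nlinarith [mul_pos hx hβ]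
  -- `log x` takes `5/18` of `xβ` and `Λ = 2xβ²/9` takes `4/18`, together exactly one half; `log 4`
  -- absorbs the `4/5`.
  have key : Real.log x + 4 / 5 + (Λ - Real.log 4) ≤ x * β / 2 := by
    linarith [log_four_ge]
  have h4Λ : 0 ≤ Λ - Real.log 4 := by
    have : Real.log 4 ≤ 2 * (Real.log 2) := by
      rw [show (4 : ℝ) = 2 ^ 2 by norm_num, Real.log_pow]; norm_num
    have := Real.log_two_lt_d9
    norm_num at *
    linarith
  have hfin : K * Real.log x + (4 / 5 * K - x * (K * β / 2)) ≤ Real.log 4 - Λ := by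
    nlinarith [mul_le_mul_of_nonneg_left key (zero_le_one.trans hk),
      mul_le_mul_of_nonneg_right hk h4Λ]
  calc x ^ K * Real.exp (4 / 5 * K - x * (K * β / 2))
      = Real.exp (K * Real.log x + (4 / 5 * K - x * (K * β / 2))) := by
        rw [Real.exp_add, Real.exp_nat_mul, Real.exp_log hx]
    _ ≤ Real.exp (Real.log 4 - Λ) := Real.exp_le_exp.2 hfin
    _ = 4 * (α / 5) := by
        rw [Real.exp_sub, Real.exp_log (by norm_num), hΛdef, Real.exp_log (by positivity)]
        field_simp

end Numerics

/-! ### Maximal coverage by sample entries and its generalization -/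

section BestRepresentatives

variable {X : Type*}

/-- If every finite part of each `D k` is covered by one of its points, then some entries of a
sample cover all of its entries in `⋃ k, D k`. -/
lemma exists_hits_iUnion_le {W : Set (X × X)} {K n : ℕ} {D : Fin K → Set X}
    (hD : ∀ k, ∀ F : Finset X, F.Nonempty → (F : Set X) ⊆ D k → ∃ x ∈ F, ∀ y ∈ F, (x, y) ∈ W)
    (hn : 0 < n) (T : Fin n → X) :
    ∃ g : Fin K → Fin n, hits (⋃ k, D k) T ≤ hits (coveredBy W (T ∘ g)) T := by
  classical
  have hg : ∀ k, ∃ j : Fin n, ∀ i, T i ∈ D k → (T j, T i) ∈ W := fun k => by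
    set F : Finset X := (Finset.univ.filter fun i => T i ∈ D k).image T
    have hFmem : ∀ i, T i ∈ D k → T i ∈ F := fun i hi =>
      Finset.mem_image_of_mem _ (Finset.mem_filter.2 ⟨Finset.mem_univ _, hi⟩)
    by_cases hF : F.Nonempty
    · obtain ⟨x, hx, hxy⟩ := hD k F hF fun y hy => by
        obtain ⟨i, hi, rfl⟩ := Finset.mem_image.1 hy
        exact (Finset.mem_filter.1 hi).2
      obtain ⟨j, -, rfl⟩ := Finset.mem_image.1 hx
      exact ⟨j, fun i hi => hxy _ (hFmem i hi)⟩
    -- No sample point lies in `D k`, so any index serves.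
    · exact ⟨⟨0, hn⟩, fun i hi => absurd ⟨_, hFmem i hi⟩ hF⟩
  choose g hg using hg
  refine ⟨g, hits_mono fun i hi => ?_⟩
  obtain ⟨k, hk⟩ := Set.mem_iUnion.1 hi
  exact ⟨k, hg k i hk⟩

variable [Inhabited X]

open Classical in
/-- `K` entries of the sample `T` that cover, in the sense of `W`, as many entries of `T` as
possible. -/
noncomputable def bestRepresentatives (W : Set (X × X)) (K n : ℕ) (T : Fin n → X) : Fin K → X :=
  if h : ∃ f : Fin K → Fin n, ∀ g : Fin K → Fin n,
      hits (coveredBy W (T ∘ g)) T ≤ hits (coveredBy W (T ∘ f)) T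
  then T ∘ h.choose else fun _ => default

lemma exists_bestRepresentatives_eq (W : Set (X × X)) (K : ℕ) {n : ℕ} (hn : 0 < n)
    (T : Fin n → X) : ∃ f : Fin K → Fin n, bestRepresentatives W K n T = T ∘ f ∧
      ∀ g : Fin K → Fin n, hits (coveredBy W (T ∘ g)) T ≤ hits (coveredBy W (T ∘ f)) T := by
  have : Nonempty (Fin n) := ⟨⟨0, hn⟩⟩
  have h : ∃ f : Fin K → Fin n, ∀ g : Fin K → Fin n,
      hits (coveredBy W (T ∘ g)) T ≤ hits (coveredBy W (T ∘ f)) T :=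
    Finite.exists_max fun f : Fin K → Fin n => hits (coveredBy W (T ∘ f)) T
  exact ⟨h.choose, by rw [bestRepresentatives, dif_pos h], h.choose_spec⟩

variable [MeasurableSpace X]

/-- Generalization bound for the best representatives from a sample, free of any assumption on the
complexity of `W`. -/
theorem measure_bestRepresentatives_le (μ : Measure X) [IsProbabilityMeasure μ] {W : Set (X × X)}
    (hW : MeasurableSet W) {K n : ℕ} (hK : 0 < K) {D : Fin K → Set X}
    (hDm : ∀ k, MeasurableSet (D k))
    (hD : ∀ k, ∀ F : Finset X, F.Nonempty → (F : Set X) ⊆ D k → ∃ x ∈ F, ∀ y ∈ F, (x, y) ∈ W)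
    {α β : ℝ} (hα : 0 < α) (hα1 : α < 1) (hβ : 0 < β)
    (hn : 9 * Real.log (5 / α) / (2 * β ^ 2) ≤ n) :
    (Measure.pi fun _ : Fin n => μ)
        {T | μ.real (coveredBy W (bestRepresentatives W K n T))
          < (1 - 1 / Real.exp 1) * (μ.real (⋃ k, D k) - K * β)} ≤ ENNReal.ofReal α := by
  have hc0 : 0 ≤ 1 - 1 / Real.exp 1 := le_trans (by norm_num) one_sub_inv_exp_mem.1
  have hΛ : 0 < Real.log (5 / α) := Real.log_pos (by rw [lt_div_iff₀ hα]; linarith)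
  have hn0 : (0 : ℝ) < n := lt_of_lt_of_le (by positivity) hn
  have hk : (1 : ℝ) ≤ K := by exact_mod_cast hK
  -- Shrinking `β` to the value that gives equality only raises the threshold, hence enlarges the
  -- bad event.
  wlog heq : (n : ℝ) = 9 * Real.log (5 / α) / (2 * β ^ 2) generalizing β with H
  · set b : ℝ := Real.sqrt (9 * Real.log (5 / α) / (2 * n)) with hb
    have hb0 : 0 < b := Real.sqrt_pos.2 (by positivity)
    have hb2 : b ^ 2 = 9 * Real.log (5 / α) / (2 * n) := Real.sq_sqrt (by positivity)
    have hbn : (n : ℝ) = 9 * Real.log (5 / α) / (2 * b ^ 2) := by rw [hb2]; field_simp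
    have hbβ : b ≤ β := by
      refine le_of_pow_le_pow_left₀ (n := 2) (by norm_num) hβ.le ?_
      rw [hb2, div_le_iff₀ (by positivity)]
      rw [div_le_iff₀ (by positivity)] at hn
      linarith
    refine (measure_mono ?_).trans (H hb0 hbn.ge hbn)
    intro T hT
    refine lt_of_lt_of_le (Set.mem_ofPred_eq ▸ hT) ?_
    gcongr
  set p := μ.real (⋃ k, D k) with hp
  set q := (1 - 1 / Real.exp 1) * (p - K * β) with hq
  have hp1 : p ≤ 1 := measureReal_le_one
  have hp0 : 0 ≤ p := measureReal_nonneg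
  -- If `p ≤ Kβ` the claimed bound is nonpositive and cannot fail; otherwise `β ≤ Kβ < p ≤ 1`.
  rcases le_or_gt (p - K * β) 0 with hneg | hpos
  · have : {T : Fin n → X | μ.real (coveredBy W (bestRepresentatives W K n T)) < q} = ∅ := by
      ext T
      simp only [Set.mem_ofPred_eq, Set.mem_empty_iff_false, iff_false, not_lt]
      exact (mul_nonpos_of_nonneg_of_nonpos hc0 hneg).trans measureReal_nonneg
    simp [this]
  have hβ1 : β ≤ 1 := by nlinarith
  have hnn : 0 < n := by exact_mod_cast hn0
  set ν := Measure.pi fun _ : Fin n => μ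
  set A : Set (Fin n → X) := {T | hits (⋃ k, D k) T ≤ n * (p - β / 3)}
  set B : (Fin K → Fin n) → Set (Fin n → X) := fun f =>
    {T | μ.real (coveredBy W (T ∘ f)) ≤ q ∧ n * (p - β / 3) ≤ hits (coveredBy W (T ∘ f)) T}
  -- Either the sample underrepresents the sets `D k`, or some choice of indices looks much better
  -- on the sample than it is.
  have hsub : {T : Fin n → X | μ.real (coveredBy W (bestRepresentatives W K n T)) < q}
      ⊆ A ∪ ⋃ f, B f := by
    intro T hT
    by_cases hA : hits (⋃ k, D k) T ≤ n * (p - β / 3)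
    · exact Or.inl hA
    · obtain ⟨f, hf, hmax⟩ := exists_bestRepresentatives_eq W K hnn T
      obtain ⟨g, hg⟩ := exists_hits_iUnion_le hD hnn T
      have hT' : μ.real (coveredBy W (bestRepresentatives W K n T)) < q := hT
      rw [hf] at hT'
      exact Or.inr (Set.mem_iUnion.2
        ⟨f, hT'.le, (not_le.1 hA).le.trans (hg.trans (hmax g))⟩)
  have hA : ν.real A ≤ α / 5 := by
    have h := measureReal_hits_le_le (ι := Fin n) μ (MeasurableSet.iUnion hDm)
      (t := β / 3) (by positivity) (by simpa using hnn)
    rw [Fintype.card_fin] at h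
    refine h.trans_eq ?_
    have : -(2 * (n : ℝ) * (β / 3) ^ 2) = -Real.log (5 / α) := by rw [heq]; field_simp; norm_num
    rw [this, Real.exp_neg, Real.exp_log (by positivity), inv_div]
  have hB : ∀ f, ν.real (B f) ≤ Real.exp (4 / 5 * K - n * (K * β / 2)) := fun f => by
    refine (measureReal_le_hits_coveredBy_le μ hW f (l := 4 / 5) (by norm_num)).trans ?_
    refine Real.exp_le_exp.2 ?_
    have h := mul_le_mul_of_nonneg_left (deviation_rate hp0 hβ.le hk) hn0.le
    rw [hq]
    linarith
  have hfin : ν.real {T : Fin n → X | μ.real (coveredBy W (bestRepresentatives W K n T)) < q}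
      ≤ α := by
    calc _ ≤ ν.real (A ∪ ⋃ f, B f) := measureReal_mono hsub
      _ ≤ ν.real A + ∑ f, ν.real (B f) :=
        (measureReal_union_le _ _).trans (by gcongr; exact measureReal_iUnion_fintype_le _)
      _ ≤ α / 5 + ∑ _f : Fin K → Fin n, Real.exp (4 / 5 * K - n * (K * β / 2)) := by
        gcongr with f; exact hB f
      _ = α / 5 + (n : ℝ) ^ K * Real.exp (4 / 5 * K - n * (K * β / 2)) := by simp
      _ ≤ α / 5 + 4 * (α / 5) := by
        linarith [pow_mul_exp_le hα hα1 hβ hβ1 hK heq]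
      _ = α := by ring
  exact (ENNReal.le_ofReal_iff_toReal_le (measure_ne_top _ _) hα.le).2 hfin

end BestRepresentatives

end PolicyCommittee

namespace PolicyCommittee

/-! ### Lipschitz values, the covering relation and the committee bound -/

section Values

variable {S A : Type*} [MeasurableSpace S] [MeasurableSpace A] {E : Environment S A}
  {P : Set (Policy S A)}

instance (E : Environment S A) (π : Policy S A) : IsProbabilityMeasure (stateLaw E π) := by
  unfold stateLaw
  infer_instance

/-- The total weight `∑_{t=0}^h γ^t` of the rewards. -/
noncomputable def totalDiscount (E : Environment S A) : ℝ :=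
  ∑ t ∈ Finset.range (E.horizon + 1), E.discount ^ t

lemma totalDiscount_nonneg (E : Environment S A) : 0 ≤ totalDiscount E :=
  Finset.sum_nonneg fun _ _ => pow_nonneg E.discount_nonneg _

lemma value_le_add {r r' : S → A → ℝ} {π : Policy S A} {b : ℝ}
    (hr : ∀ t ≤ E.horizon, Integrable (fun s : ℕ → S => r (s t) (π.1 (s t))) (stateLaw E π))
    (hr' : ∀ t ≤ E.horizon, Integrable (fun s : ℕ → S => r' (s t) (π.1 (s t))) (stateLaw E π))
    (hb : ∀ s a, r s a ≤ r' s a + b) :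
    value E r π ≤ value E r' π + totalDiscount E * b := by
  have hsum : ∀ {r : S → A → ℝ},
      (∀ t ≤ E.horizon, Integrable (fun s : ℕ → S => r (s t) (π.1 (s t))) (stateLaw E π)) →
      Integrable (fun s : ℕ → S => ∑ t ∈ Finset.range (E.horizon + 1),
        E.discount ^ t * r (s t) (π.1 (s t))) (stateLaw E π) := fun h =>
    integrable_finsetSum _ fun t ht =>
      (h t (Nat.lt_succ_iff.1 (Finset.mem_range.1 ht))).const_mul _
  have hconst : ∫ _s, totalDiscount E * b ∂(stateLaw E π) = totalDiscount E * b := by simp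
  unfold value
  rw [← hconst, ← integral_add (hsum hr') (integrable_const _)]
  refine integral_mono (hsum hr) ((hsum hr').add (integrable_const _)) fun s => ?_
  change _ ≤ _ + totalDiscount E * b
  rw [totalDiscount, Finset.sum_mul, ← Finset.sum_add_distrib]
  refine Finset.sum_le_sum fun t _ => ?_
  rw [← mul_add]
  exact mul_le_mul_of_nonneg_left (hb _ _) (pow_nonneg E.discount_nonneg _)

lemma optValue_le_add {r r' : S → A → ℝ} {b : ℝ} (hP : P.Nonempty)
    (hbdd : BddAbove ((fun π => value E r' π) '' P))
    (hb : ∀ π ∈ P, value E r π ≤ value E r' π + b) :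
    optValue E P r ≤ optValue E P r' + b := by
  refine csSup_le (hP.image _) ?_
  rintro _ ⟨π, hπ, rfl⟩
  exact (hb π hπ).trans (by gcongr; exact le_csSup hbdd ⟨π, hπ, rfl⟩)

/-- The parameter `x` represents the parameter `y` if they are within distance `2ε` and the optimal
value of `x` is at least that of `y`. The latter halves the loss incurred at `y` by a policy that is
nearly optimal for `x`. -/
def representsWithin {d : ℕ} (V : (Fin d → ℝ) → ℝ) (ε : ℝ) : Set ((Fin d → ℝ) × (Fin d → ℝ)) :=
  {p | ‖p.2 - p.1‖ ≤ 2 * ε ∧ V p.2 ≤ V p.1}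

lemma measurableSet_representsWithin {d : ℕ} {V : (Fin d → ℝ) → ℝ} (hV : Continuous V) (ε : ℝ) :
    MeasurableSet (representsWithin V ε) :=
  (IsClosed.inter (s₁ := {p : (Fin d → ℝ) × (Fin d → ℝ) | ‖p.2 - p.1‖ ≤ 2 * ε})
    (s₂ := {p : (Fin d → ℝ) × (Fin d → ℝ) | V p.2 ≤ V p.1})
    (isClosed_le (by fun_prop) continuous_const)
    (isClosed_le (hV.comp continuous_snd) (hV.comp continuous_fst))).measurableSet

/-- A maximizer of `V` on `F` works, as two points of the ball are within `2ε`. The centre `c`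
itself need not be in the sample. -/
lemma exists_representsWithin {d : ℕ} (V : (Fin d → ℝ) → ℝ) {ε : ℝ} (c : Fin d → ℝ)
    (F : Finset (Fin d → ℝ)) (hF : F.Nonempty) (hFc : (F : Set (Fin d → ℝ)) ⊆ {θ | ‖θ - c‖ ≤ ε}) :
    ∃ x ∈ F, ∀ y ∈ F, (x, y) ∈ representsWithin V ε := by
  obtain ⟨x, hx, hmax⟩ := F.exists_max_image V hF
  refine ⟨x, hx, fun y hy => ⟨?_, hmax y hy⟩⟩
  have h1 : ‖x - c‖ ≤ ε := hFc hx
  have h2 : ‖y - c‖ ≤ ε := hFc hy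
  calc ‖y - x‖ = ‖(y - c) - (x - c)‖ := by rw [sub_sub_sub_cancel_right]
    _ ≤ ‖y - c‖ + ‖x - c‖ := norm_sub_le _ _
    _ ≤ 2 * ε := by linarith

/-- A parameter-cover exists for each failure probability above `δ*`. -/
lemma exists_isParameterCover_of_deltaStar_lt {d K : ℕ} (Γ : Measure (Fin d → ℝ)) {ε u : ℝ}
    (hu : deltaStar Γ K ε < u) : ∃ C : Fin K → Fin d → ℝ, IsParameterCover Γ C ε (1 - u) := by
  have hne : {δ : ℝ | 0 ≤ δ ∧ δ ≤ 1 ∧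
      ∃ C : Fin K → Fin d → ℝ, IsParameterCover Γ C ε (1 - δ)}.Nonempty :=
    ⟨1, zero_le_one, le_rfl, fun _ => 0, by simp [IsParameterCover]⟩
  obtain ⟨δ, ⟨-, -, C, hC⟩, hδ⟩ := exists_lt_of_csInf_lt hne hu
  exact ⟨C, le_trans (by linarith) hC⟩

/-- The committee of policies that solve the best representatives of a sample is a cover. -/
theorem measure_not_isCommitteeCover_le {d : ℕ} {r : (Fin d → ℝ) → S → A → ℝ}
    (hint : ∀ θ, ∀ π ∈ P, ∀ t ≤ E.horizon,
      Integrable (fun s : ℕ → S => r θ (s t) (π.1 (s t))) (stateLaw E π))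
    (hbdd : ∀ θ, BddAbove ((fun π => value E (r θ) π) '' P))
    {L : ℝ} (hL : 0 ≤ L) (hlip : ∀ θ θ' s a, |r θ s a - r θ' s a| ≤ L * ‖θ - θ'‖)
    {K : ℕ} (hK : 0 < K) {ε η : ℝ} {solve : (Fin d → ℝ) → Policy S A}
    (hsolve : ∀ θ, solve θ ∈ P ∧ value E (r θ) (solve θ) ≥ optValue E P (r θ) - η)
    (Γ : Measure (Fin d → ℝ)) [IsProbabilityMeasure Γ] {α β : ℝ} {n : ℕ}
    (hα : 0 < α) (hα1 : α < 1) (hβ : 0 < β) (hn : 9 * Real.log (5 / α) / (2 * β ^ 2) ≤ n) :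
    Measure.pi (fun _ : Fin n => Γ)
      {T | ¬ IsCommitteeCover E P r Γ (fun k => solve
          (bestRepresentatives (representsWithin (fun θ => optValue E P (r θ)) ε) K n T k))
        (2 * L * totalDiscount E * ε + η)
        ((1 - 1 / Real.exp 1) * (1 - deltaStar Γ K ε - K * β))} ≤ ENNReal.ofReal α := by
  set V : (Fin d → ℝ) → ℝ := fun θ => optValue E P (r θ) with hV
  set W := representsWithin V ε with hW
  set rep := fun T => bestRepresentatives W K n T with hrep
  have hG := totalDiscount_nonneg E
  have hval : ∀ θ θ', ∀ π ∈ P,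
      value E (r θ) π ≤ value E (r θ') π + totalDiscount E * (L * ‖θ - θ'‖) := fun θ θ' π hπ =>
    value_le_add (hint θ π hπ) (hint θ' π hπ) fun s a => by
      linarith [(abs_le.1 (hlip θ θ' s a)).2]
  -- Continuity of the optimal value makes the covering relation measurable.
  have hVlip : LipschitzWith (totalDiscount E * L).toNNReal V :=
    LipschitzWith.of_le_add_mul _ fun θ θ' => by
      rw [Real.coe_toNNReal _ (by positivity), dist_eq_norm, mul_assoc]
      exact optValue_le_add ⟨_, (hsolve 0).1⟩ (hbdd θ') (hval θ θ')
  have hWm : MeasurableSet W := measurableSet_representsWithin hVlip.continuous ε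
  have hloss : ∀ T : Fin n → Fin d → ℝ, Γ.real (coveredBy W (rep T)) ≤
      Γ.real {θ | optValue E P (r θ) - (2 * L * totalDiscount E * ε + η) ≤
        committeeValue E (r θ) fun k => solve (rep T k)} := fun T => by
    refine measureReal_mono ?_
    rintro y ⟨k, hdist, hVy⟩
    have h1 := (hsolve (rep T k)).2
    have h2 := hval (rep T k) y _ (hsolve (rep T k)).1
    have h3 : totalDiscount E * (L * ‖rep T k - y‖) ≤ totalDiscount E * (L * (2 * ε)) := by
      rw [norm_sub_rev]; gcongr
    have h4 : value E (r y) (solve (rep T k))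
        ≤ committeeValue E (r y) fun k => solve (rep T k) :=
      le_ciSup (f := fun k => value E (r y) (solve (rep T k))) (Set.finite_range _).bddAbove k
    have h5 : optValue E P (r y) ≤ optValue E P (r (rep T k)) := hVy
    change optValue E P (r y) - _ ≤ _
    linarith
  have hc0 : 0 < 1 - 1 / Real.exp 1 := lt_of_lt_of_le (by norm_num) one_sub_inv_exp_mem.1
  -- The infimum `δ*` is not known to be attained, so it is approached from above by `δ* + 1/(m+1)`.
  -- The bad events increase with `m` and each has measure at most `α`, so their union does too,
  -- with no loss in the confidence.
  let u : ℕ → ℝ := fun m =>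
    (1 - 1 / Real.exp 1) * (1 - (deltaStar Γ K ε + 1 / ((m : ℝ) + 1)) - K * β)
  have hu : Monotone u := fun m m' hm => by
    have : 1 / ((m' : ℝ) + 1) ≤ 1 / ((m : ℝ) + 1) := by gcongr
    exact mul_le_mul_of_nonneg_left (by linarith) hc0.le
  have hulim : Filter.Tendsto u Filter.atTop
      (nhds ((1 - 1 / Real.exp 1) * (1 - (deltaStar Γ K ε + 0) - K * β))) :=
    (((tendsto_one_div_add_atTop_nhds_zero_nat.const_add _).const_sub _).sub_const _).const_mul _
  rw [add_zero] at hulim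
  let bad : ℕ → Set (Fin n → Fin d → ℝ) := fun m => {T | Γ.real (coveredBy W (rep T)) < u m}
  have hbad : ∀ m, Measure.pi (fun _ : Fin n => Γ) (bad m) ≤ ENNReal.ofReal α := fun m => by
    obtain ⟨C, hC⟩ := exists_isParameterCover_of_deltaStar_lt (K := K) (ε := ε) Γ
      (u := deltaStar Γ K ε + 1 / ((m : ℝ) + 1))
      (by linarith [Nat.one_div_pos_of_nat (α := ℝ) (n := m)])
    refine (measure_mono ?_).trans (measure_bestRepresentatives_le Γ hWm hK
      (D := fun k => {θ | ‖θ - C k‖ ≤ ε})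
      (fun k => (isClosed_le (by fun_prop) continuous_const).measurableSet)
      (fun k F hF hFc => exists_representsWithin V (C k) F hF hFc) hα hα1 hβ hn)
    intro T hT
    refine lt_of_lt_of_le hT (mul_le_mul_of_nonneg_left (sub_le_sub_right ?_ _) hc0.le)
    refine le_trans hC (le_of_eq ?_)
    congr 1
    ext θ
    simp
  calc _ ≤ Measure.pi (fun _ : Fin n => Γ) (⋃ m, bad m) := measure_mono fun T hT => by
        have hT' := (hloss T).trans_lt (not_le.1 hT)
        obtain ⟨m, hm⟩ := (hulim.eventually (lt_mem_nhds hT')).exists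
        exact Set.mem_iUnion.2 ⟨m, hm⟩
    _ = ⨆ m, Measure.pi (fun _ : Fin n => Γ) (bad m) :=
        Monotone.measure_iUnion fun m m' hm T hT => lt_of_lt_of_le hT (hu hm)
    _ ≤ ENNReal.ofReal α := iSup_le hbad

end Values

end PolicyCommittee

theorem theorem3 {S A : Type*} [MeasurableSpace S] [MeasurableSpace A]
    (E : PolicyCommittee.Environment S A)
    (P : Set (PolicyCommittee.Policy S A))
    (d : ℕ) (r : (Fin d → ℝ) → S → A → ℝ)
    -- expected rewards and optimal values exist
    (hint : ∀ θ, ∀ π ∈ P, ∀ t ≤ E.horizon,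
      MeasureTheory.Integrable (fun s : ℕ → S => r θ (s t) (π.1 (s t)))
        (PolicyCommittee.stateLaw E π))
    (hbdd : ∀ θ, BddAbove ((fun π => PolicyCommittee.value E (r θ) π) '' P))
    -- rewards are `L`-Lipschitz in the parameter, in `ℓ_∞`
    (L : ℝ) (hL : 0 ≤ L)
    (hlip : ∀ θ θ' s a, |r θ s a - r θ' s a| ≤ L * ‖θ - θ'‖)
    (K : ℕ) (hK : 0 < K) (ε : ℝ) (hε : 0 ≤ ε) :
    -- the procedure that computes `K` representatives from `n` sampled tasks
    ∃ cluster : (n : ℕ) → (Fin n → Fin d → ℝ) → Fin K → Fin d → ℝ,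
      -- any `η`-optimal method to solve a single task
      ∀ (η : ℝ) (solve : (Fin d → ℝ) → PolicyCommittee.Policy S A),
        (∀ θ, solve θ ∈ P ∧ PolicyCommittee.value E (r θ) (solve θ) ≥
          PolicyCommittee.optValue E P (r θ) - η) →
      ∀ (Γ : MeasureTheory.Measure (Fin d → ℝ)) [MeasureTheory.IsProbabilityMeasure Γ]
        (α β : ℝ) (n : ℕ), 0 < α → α < 1 → 0 < β →
        9 * Real.log (5 / α) / (2 * β ^ 2) ≤ (n : ℝ) →
        -- for `n` i.i.d. samples, failure has (outer) probability at most `α`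
        (E.discount < 1 →
          MeasureTheory.Measure.pi (fun _ : Fin n => Γ)
            {T | ¬ PolicyCommittee.IsCommitteeCover E P r Γ (fun k => solve (cluster n T k))
              (2 * L * ((1 - E.discount ^ (E.horizon + 1)) / (1 - E.discount)) * ε + η)
              ((1 - 1 / Real.exp 1) * (1 - PolicyCommittee.deltaStar Γ K ε - K * β))}
            ≤ ENNReal.ofReal α) ∧
        (E.discount = 1 →
          MeasureTheory.Measure.pi (fun _ : Fin n => Γ)
            {T | ¬ PolicyCommittee.IsCommitteeCover E P r Γ (fun k => solve (cluster n T k))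
              (2 * L * (E.horizon + 1) * ε + η)
              ((1 - 1 / Real.exp 1) * (1 - PolicyCommittee.deltaStar Γ K ε - K * β))}
            ≤ ENNReal.ofReal α) := by
  refine ⟨PolicyCommittee.bestRepresentatives (PolicyCommittee.representsWithin
    (fun θ => PolicyCommittee.optValue E P (r θ)) ε) K, ?_⟩
  intro η solve hsolve Γ _ α β n hα hα1 hβ hn
  have key := PolicyCommittee.measure_not_isCommitteeCover_le hint hbdd hL hlip hK (ε := ε)
    hsolve Γ hα hα1 hβ hn
  refine ⟨fun hγ => ?_, fun hγ => ?_⟩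
  · have hG : PolicyCommittee.totalDiscount E
        = (1 - E.discount ^ (E.horizon + 1)) / (1 - E.discount) := by
      rw [PolicyCommittee.totalDiscount, geom_sum_eq hγ.ne, ← neg_div_neg_eq, neg_sub, neg_sub]
    rwa [hG] at key
  · have hG : PolicyCommittee.totalDiscount E = E.horizon + 1 := by
      simp [PolicyCommittee.totalDiscount, hγ]
    rwa [hG] at key
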